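/- Let $n\ge 3$, let $\mathbb B^n$ be the open unit ball of $\mathbb R^n$ and $\overline{\mathbb B^n}$ its closure. For every $\varepsilon>0$ there is $L>0$, depending only on $n$ and $\varepsilon$, such that the following holds. Let $\Omega\subset\mathbb R^n$ be a bounded domain of class $\mathcal C^1$, and let $\Phi\colon\overline\Omega\to\overline{\mathbb B^n}$ be a $\mathcal C^1$-diffeomorphism (a bijection which is $\mathcal C^1$ up to the boundary, as is its inverse) with $$\|\Phi-\mathrm{Id}\|_{\mathcal C^1(\Omega)}\le L,\qquad\text{where } \|f\|_{\mathcal C^1(\Omega)}=\sup_\Omega|f|+\sup_\Omega\|df\|.$$ Then there is a family $(\Phi_a)_{a\in\overline\Omega}$ of $\mathcal C^1$-diffeomorphisms $\Phi_a\colon\overline\Omega\to\overline{\mathbb B^n}$ such that: 1. $\Phi_a(a)=\Phi(a)$ for every $a\in\overline\Omega$. 2. If $a\in\partial\Omega$, then (i) there are $\beta_a\in\mathbb R$ and $R_a\in O_n(\mathbb R)$ with $d\Phi_a(a)=\beta_aR_a$, and (ii) $\|\Phi_a-\mathrm{Id}\|_{\mathcal C^1(\Omega)}<\varepsilon$. 3.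 For every $a\in\overline\Omega$, as $a'\to a$ in $\overline\Omega$: $\Phi_{a'}(x)\to\Phi_a(x)$ and $d\Phi_{a'}(x)\to d\Phi_a(x)$ for almost every $x\in\Omega$, and $\Phi_{a'}^{-1}(y)\to\Phi_a^{-1}(y)$ and $d(\Phi_{a'}^{-1})(y)\to d(\Phi_a^{-1})(y)$ for almost every $y\in\mathbb B^n$. -/

import Mathlib

open Set Filter Topology MeasureTheory Metric
open scoped ENNReal

/-- `Ω` is a bounded `C¹` domain of `ℝⁿ`: nonempty, connected, open and bounded, and near each
boundary point `Ω` is the positivity set, and `∂Ω` the zero set, of a `C¹` function `ρ`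
without critical points. -/
structure IsBoundedC1Domain {n : ℕ} (Ω : Set (EuclideanSpace ℝ (Fin n))) : Prop where
  isOpen : IsOpen Ω
  isConnected : IsConnected Ω
  isBounded : Bornology.IsBounded Ω
  boundary : ∀ a ∈ frontier Ω, ∃ r : ℝ, 0 < r ∧ ∃ ρ : EuclideanSpace ℝ (Fin n) → ℝ,
    ContDiffOn ℝ 1 ρ (ball a r) ∧
    Ω ∩ ball a r = {x ∈ ball a r | 0 < ρ x} ∧
    frontier Ω ∩ ball a r = {x ∈ ball a r | ρ x = 0} ∧
    ∀ x ∈ ball a r, fderiv ℝ ρ x ≠ 0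

/-- `f` restricts to a `C¹` diffeomorphism from `s` onto `t`, with inverse (the restriction of)
`g`. It is used for closures of `C¹` domains, where `ContDiffOn ℝ 1` means `C¹` up to the
boundary. -/
structure IsC1Diffeo {n : ℕ} (s t : Set (EuclideanSpace ℝ (Fin n)))
    (f g : EuclideanSpace ℝ (Fin n) → EuclideanSpace ℝ (Fin n)) : Prop where
  mapsTo : MapsTo f s t
  mapsTo_inv : MapsTo g t s
  invOn : InvOn g f s t
  contDiffOn : ContDiffOn ℝ 1 f s
  contDiffOn_inv : ContDiffOn ℝ 1 g t

/-- The `C¹` norm `sup_{x ∈ s} |f x| + sup_{x ∈ s} ‖df x‖` (Euclidean norm, operator norm), as an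
extended nonnegative number, so that no boundedness has to be presupposed. -/
noncomputable def c1Norm {n : ℕ} (s : Set (EuclideanSpace ℝ (Fin n)))
    (f : EuclideanSpace ℝ (Fin n) → EuclideanSpace ℝ (Fin n)) : ℝ≥0∞ :=
  (⨆ x ∈ s, ‖f x‖ₑ) + ⨆ x ∈ s, ‖fderivWithin ℝ f s x‖ₑ

/-! Take `Φ_a = T_b ∘ Φ` with `b = Φ a`, where `T_b` is a norm-preserving diffeomorphism of the
closed ball that fixes `b` and is `C¹`-close to the identity. Property 1 is then immediate. For `‖b‖
= 1`, the twist `sphereTwist A b` has derivative `1 + A` at `b` as soon as `A` takes values in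
`b^⊥`. With `D = dΦ(a)`, `conformalCorrection D b` is such an `A`, and `(1 + A) D` is a multiple of
an isometry. Since `A` depends continuously on `(D, b)` near `D = 1` and vanishes at `D = 1`, a
small `L` makes `A`, hence `T_b - Id`, small; compactness makes this uniform in `b`. The operators
`A`, prescribed on the sphere, extend radially to the ball. The resulting `A b` is continuous in
`b`, so `T_b`, its inverse and their derivatives vary continuously with `a`, which gives property 3
at every point. -/

section SphereTwist

/-! ### Norm-preserving twists of the ball. -/

variable {E : Type*} [NormedAddCommGroup E] [InnerProductSpace ℝ E]

/-- The squared tangent of half the angle by which `sphereTwist A b` rotates `x`. -/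
noncomputable def sqTanHalfAngle (A : E →L[ℝ] E) (b x : E) : ℝ :=
  (‖x‖ ^ 2 * ‖A (x - b)‖ ^ 2 - inner ℝ (A (x - b)) x ^ 2) / 4

/-- A norm-preserving map which fixes `b` and moves `x` in the direction `A (x - b)`. -/
noncomputable def sphereTwist (A : E →L[ℝ] E) (b x : E) : E :=
  (1 + sqTanHalfAngle A b x)⁻¹ • ((1 - sqTanHalfAngle A b x) • x +
    (‖x‖ ^ 2 • A (x - b) - inner ℝ (A (x - b)) x • x))

theorem sqTanHalfAngle_nonneg (A : E →L[ℝ] E) (b x : E) : 0 ≤ sqTanHalfAngle A b x := by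
  have h := abs_real_inner_le_norm (A (x - b)) x
  have h2 : inner ℝ (A (x - b)) x ^ 2 ≤ (‖A (x - b)‖ * ‖x‖) ^ 2 := by
    rw [← sq_abs]; gcongr
  unfold sqTanHalfAngle
  nlinarith

/-- With `v = A (x - b)` and `q` the squared half-angle tangent, `w = ‖x‖² v - ⟪v, x⟫ x` is
orthogonal to `x` and `‖w‖² = 4 q ‖x‖²`. So `((1 - q) x + w) / (1 + q)` is the rational
parametrisation of a rotation in the plane of `x` and `v`; it is smooth even where `v` and `x` are
parallel. -/
theorem norm_sphereTwist (A : E →L[ℝ] E) (b x : E) : ‖sphereTwist A b x‖ = ‖x‖ := by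
  have hq := sqTanHalfAngle_nonneg A b x
  have hdef : 4 * sqTanHalfAngle A b x =
      ‖x‖ ^ 2 * ‖A (x - b)‖ ^ 2 - inner ℝ (A (x - b)) x ^ 2 := by
    unfold sqTanHalfAngle; ring
  unfold sphereTwist
  set q := sqTanHalfAngle A b x
  set v := A (x - b)
  rw [norm_smul, norm_inv, Real.norm_of_nonneg (by linarith : 0 ≤ 1 + q),
    inv_mul_eq_iff_eq_mul₀ (by linarith : 1 + q ≠ 0)]
  refine (sq_eq_sq₀ (norm_nonneg _) (by positivity)).1 ?_
  have e : (1 - q) • x + (‖x‖ ^ 2 • v - inner ℝ v x • x) =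
      (1 - q - inner ℝ v x) • x + (‖x‖ ^ 2) • v := by
    module
  rw [e, norm_add_sq_real, norm_smul, norm_smul, real_inner_smul_left, real_inner_smul_right,
    real_inner_comm v x, mul_pow, mul_pow, Real.norm_eq_abs, Real.norm_eq_abs, sq_abs, sq_abs]
  linear_combination (-‖x‖ ^ 2) * hdef

@[simp] theorem sphereTwist_self (A : E →L[ℝ] E) (b : E) : sphereTwist A b b = b := by
  simp [sphereTwist, sqTanHalfAngle]

@[simp] theorem sphereTwist_zero_left (b x : E) : sphereTwist 0 b x = x := by
  simp [sphereTwist, sqTanHalfAngle]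

theorem contDiff_sphereTwist :
    ContDiff ℝ 2 (fun z : (E →L[ℝ] E) × E × E => sphereTwist z.1 z.2.1 z.2.2) := by
  have hx : ContDiff ℝ 2 (fun z : (E →L[ℝ] E) × E × E => z.2.2) := by fun_prop
  have hv : ContDiff ℝ 2 (fun z : (E →L[ℝ] E) × E × E => z.1 (z.2.2 - z.2.1)) := by
    fun_prop
  have hi := hv.inner ℝ hx
  have hq : ContDiff ℝ 2 (fun z : (E →L[ℝ] E) × E × E => sqTanHalfAngle z.1 z.2.1 z.2.2) := by
    unfold sqTanHalfAngle
    exact (((hx.norm_sq ℝ).mul (hv.norm_sq ℝ)).sub (hi.pow 2)).div_const 4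
  unfold sphereTwist
  refine ContDiff.smul (ContDiff.inv (contDiff_const.add hq) fun z => ?_)
    (((contDiff_const.sub hq).smul hx).add (((hx.norm_sq ℝ).smul hv).sub (hi.smul hx)))
  have := sqTanHalfAngle_nonneg z.1 z.2.1 z.2.2
  linarith

theorem contDiff_sphereTwist_apply (A : E →L[ℝ] E) (b : E) : ContDiff ℝ 2 (sphereTwist A b) := by
  have h : ContDiff ℝ 2 (fun x : E => (A, b, x)) := by fun_prop
  have h2 := (contDiff_sphereTwist (E := E)).comp h
  simpa only [Function.comp_def] using h2

theorem continuous_fderiv_sphereTwist :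
    Continuous (fun z : (E →L[ℝ] E) × E × E => fderiv ℝ (sphereTwist z.1 z.2.1) z.2.2) := by
  have h : ∀ z : (E →L[ℝ] E) × E × E, fderiv ℝ (sphereTwist z.1 z.2.1) z.2.2 =
      (fderiv ℝ (fun z : (E →L[ℝ] E) × E × E => sphereTwist z.1 z.2.1 z.2.2) z).comp
        ((ContinuousLinearMap.inr ℝ (E →L[ℝ] E) (E × E)).comp
          (ContinuousLinearMap.inr ℝ E E)) := by
    rintro ⟨A, b, x⟩
    have h1 : HasFDerivAt (fun z : (E →L[ℝ] E) × E × E => sphereTwist z.1 z.2.1 z.2.2) _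
        (A, b, x) :=
      ((contDiff_sphereTwist (E := E)).differentiable (by norm_num) (A, b, x)).hasFDerivAt
    have h2 : HasFDerivAt (fun y : E => (A, b, y))
        ((ContinuousLinearMap.inr ℝ (E →L[ℝ] E) (E × E)).comp
          (ContinuousLinearMap.inr ℝ E E)) x := by
      have h3 : HasFDerivAt (fun y : E => (b, y)) (ContinuousLinearMap.inr ℝ E E) x :=
        hasFDerivAt_prodMk_right b x
      exact (hasFDerivAt_prodMk_right A (b, x)).comp x h3
    exact (h1.comp x h2).fderiv
  simp_rw [h]
  exact ((contDiff_sphereTwist (E := E)).continuous_fderiv (by norm_num)).clm_comp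
    continuous_const

theorem Filter.Tendsto.sphereTwist {ι : Type*} {l : Filter ι} {A : ι → E →L[ℝ] E} {b x : ι → E}
    {A₀ : E →L[ℝ] E} {b₀ x₀ : E} (hA : Tendsto A l (𝓝 A₀)) (hb : Tendsto b l (𝓝 b₀))
    (hx : Tendsto x l (𝓝 x₀)) :
    Tendsto (fun i => sphereTwist (A i) (b i) (x i)) l (𝓝 (sphereTwist A₀ b₀ x₀)) := by
  have h := ((contDiff_sphereTwist (E := E)).continuous.tendsto (A₀, b₀, x₀)).comp
    (hA.prodMk_nhds (hb.prodMk_nhds hx))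
  simpa only [Function.comp_def] using h

theorem Filter.Tendsto.fderiv_sphereTwist {ι : Type*} {l : Filter ι} {A : ι → E →L[ℝ] E}
    {b x : ι → E} {A₀ : E →L[ℝ] E} {b₀ x₀ : E} (hA : Tendsto A l (𝓝 A₀)) (hb : Tendsto b l (𝓝 b₀))
    (hx : Tendsto x l (𝓝 x₀)) :
    Tendsto (fun i => fderiv ℝ (_root_.sphereTwist (A i) (b i)) (x i)) l
      (𝓝 (fderiv ℝ (_root_.sphereTwist A₀ b₀) x₀)) := by
  have h := ((continuous_fderiv_sphereTwist (E := E)).tendsto (A₀, b₀, x₀)).comp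
    (hA.prodMk_nhds (hb.prodMk_nhds hx))
  simpa only [Function.comp_def] using h

/-- `sqTanHalfAngle` vanishes to second order at `b`, so only `x` and the tangential term
contribute. Orthogonality to `b` removes the projection from that term. -/
theorem hasFDerivAt_sphereTwist_self {A : E →L[ℝ] E} {b : E} (hb : ‖b‖ = 1)
    (hA : ∀ v, inner ℝ (A v) b = 0) :
    HasFDerivAt (sphereTwist A b) (1 + A) b := by
  have hx : HasFDerivAt (fun x : E => x) (1 : E →L[ℝ] E) b := hasFDerivAt_id b
  have hv : HasFDerivAt (fun x : E => A (x - b)) A b := by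
    exact (A.hasFDerivAt (x := b - b)).comp (f := fun x => x - b) b (hx.sub_const b)
  have hi := hv.inner ℝ hx
  have hq : HasFDerivAt (sqTanHalfAngle A b) (0 : E →L[ℝ] ℝ) b := by
    have h := (((hx.norm_sq).mul (hv.norm_sq)).sub (hi.pow 2)).mul_const (4⁻¹ : ℝ)
    have h' : HasFDerivAt (sqTanHalfAngle A b) _ b := h
    exact h'.congr_fderiv (by ext v; simp)
  have hinv : HasFDerivAt (fun x => (1 + sqTanHalfAngle A b x)⁻¹) (0 : E →L[ℝ] ℝ) b := by
    have h := (hasDerivAt_inv (x := 1 + sqTanHalfAngle A b b)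
      (by simp [sqTanHalfAngle])).comp_hasFDerivAt b
      (hq.const_add 1)
    exact h.congr_fderiv (smul_zero _)
  have h := hinv.smul (((hq.const_sub 1).smul hx).add
    (((hx.norm_sq).smul hv).sub (hi.smul hx)))
  have h' : HasFDerivAt (sphereTwist A b) _ b := h
  refine h'.congr_fderiv ?_
  ext v
  simp [sqTanHalfAngle, hb, hA]

/-- The twist by `A = 0` is the identity; joint continuity and compactness in `(b, x)` make
closeness uniform. Radius 2 leaves room for the inversion on the unit ball. -/
theorem exists_sphereTwist_close [FiniteDimensional ℝ E] {η : ℝ} (hη : 0 < η) :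
    ∃ r > 0, ∀ A : E →L[ℝ] E, ‖A‖ < r → ∀ b ∈ closedBall (0 : E) 1, ∀ x ∈ closedBall (0 : E) 2,
      ‖sphereTwist A b x - x‖ ≤ η ∧ ‖fderiv ℝ (sphereTwist A b) x - 1‖ ≤ η := by
  have hK : IsCompact (closedBall (0 : E) 1 ×ˢ closedBall (0 : E) 2) :=
    (isCompact_closedBall _ _).prod (isCompact_closedBall _ _)
  have key : ∀ᶠ A in 𝓝 (0 : E →L[ℝ] E), ∀ p ∈ closedBall (0 : E) 1 ×ˢ closedBall (0 : E) 2,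
      ‖sphereTwist A p.1 p.2 - p.2‖ < η ∧ ‖fderiv ℝ (sphereTwist A p.1) p.2 - 1‖ < η := by
    refine hK.eventually_forall_of_forall_eventually fun p _ => ?_
    have h1 : Continuous fun z : (E →L[ℝ] E) × E × E =>
        ‖sphereTwist z.1 z.2.1 z.2.2 - z.2.2‖ :=
      (contDiff_sphereTwist.continuous.sub (continuous_snd.comp continuous_snd)).norm
    have h2 : Continuous fun z : (E →L[ℝ] E) × E × E =>
        ‖fderiv ℝ (sphereTwist z.1 z.2.1) z.2.2 - 1‖ :=
      (continuous_fderiv_sphereTwist.sub continuous_const).norm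
    have e : sphereTwist (0 : E →L[ℝ] E) p.1 = id := funext fun x => by simp
    refine (h1.continuousAt.eventually_lt continuousAt_const ?_).and
      (h2.continuousAt.eventually_lt continuousAt_const ?_)
    · simpa using hη
    · simpa [e, ContinuousLinearMap.one_def] using hη
  obtain ⟨r, hr, h⟩ := Metric.eventually_nhds_iff.1 key
  refine ⟨r, hr, fun A hA b hb x hx => ?_⟩
  have := h (y := A) (by simpa using hA) (b, x) ⟨hb, hx⟩
  exact ⟨this.1.le, this.2.le⟩

theorem ContinuousLinearMap.isUnit_of_norm_sub_one_lt_one [CompleteSpace E] {D : E →L[ℝ] E}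
    (h : ‖D - 1‖ < 1) : IsUnit D := by
  have := isUnit_one_sub_of_norm_lt_one (x := 1 - D) (by rwa [norm_sub_rev])
  simpa using this

/-- A norm-preserving map close to the identity on a ball twice as large is a diffeomorphism of
the closed unit ball. -/
theorem exists_inverse_of_close [FiniteDimensional ℝ E] [Nontrivial E] {T : E → E}
    (hT : ContDiff ℝ 1 T) (hn : ∀ x, ‖T x‖ = ‖x‖)
    (hc : ∀ x ∈ closedBall (0 : E) 2, ‖fderiv ℝ T x - 1‖ ≤ 1 / 2) :
    ∃ S : E → E, MapsTo S (closedBall 0 1) (closedBall 0 1) ∧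
      InvOn S T (closedBall 0 1) (closedBall 0 1) ∧
      (∀ x ∈ closedBall (0 : E) 1, ∀ y ∈ closedBall (0 : E) 1, ‖x - y‖ ≤ 2 * ‖T x - T y‖) ∧
      ∀ y ∈ closedBall (0 : E) 1, ContDiffAt ℝ 1 S y ∧
        HasFDerivAt S (Ring.inverse (fderiv ℝ T (S y))) y := by
  have : CompleteSpace E := FiniteDimensional.complete ℝ E
  have hd : Differentiable ℝ T := hT.differentiable (by norm_num)
  have happ : ApproximatesLinearOn T ((ContinuousLinearEquiv.refl ℝ E : E ≃L[ℝ] E) : E →L[ℝ] E)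
      (closedBall 0 2) (1 / 2) := by
    intro x hx y hy
    have := (convex_closedBall (0 : E) 2).norm_image_sub_le_of_norm_fderiv_le' (f := T) (φ := 1)
      (fun z _ => hd z) hc hy hx
    simpa using this
  have hlt : Subsingleton E ∨
      (1 / 2 : NNReal) < ‖((ContinuousLinearEquiv.refl ℝ E).symm : E →L[ℝ] E)‖₊⁻¹ := by
    right
    have : ‖((ContinuousLinearEquiv.refl ℝ E).symm : E →L[ℝ] E)‖₊ = 1 :=
      NNReal.eq (ContinuousLinearMap.norm_id)
    rw [this, inv_one]
    exact NNReal.half_lt_self one_ne_zero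
  have hlip : ∀ x ∈ closedBall (0 : E) 2, ∀ y ∈ closedBall (0 : E) 2,
      ‖x - y‖ ≤ 2 * ‖T x - T y‖ := by
    intro x hx y hy
    have h := happ x hx y hy
    simp only [ContinuousLinearEquiv.coe_coe, ContinuousLinearEquiv.refl_apply] at h
    have h3 := norm_sub_norm_le (x - y) (T x - T y)
    rw [norm_sub_rev (x - y)] at h3
    norm_num at h
    linarith
  have hsurj : ∀ y ∈ closedBall (0 : E) 1, ∃ x ∈ closedBall (0 : E) 1, T x = y := by
    intro y hy
    -- `T - Id` is `1/2`-Lipschitz on the ball of radius 2, so the image of that ball covers radius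
    -- `(1 - 1/2) * 2 = 1` about `T 0 = 0`. Norm preservation then places the preimages in the unit
    -- ball.
    have h := happ.surjOn_closedBall_of_nonlinearRightInverse
      (ContinuousLinearEquiv.refl ℝ E).toNonlinearRightInverse (b := 0) (ε := 2) zero_le_two
      subset_rfl
    have e : (ContinuousLinearEquiv.refl ℝ E).toNonlinearRightInverse.nnnorm = 1 :=
      NNReal.eq (ContinuousLinearMap.norm_id)
    have e0 : T 0 = 0 := by rw [← norm_eq_zero, hn, norm_zero]
    rw [e, e0] at h
    norm_num at h
    obtain ⟨x, -, rfl⟩ := h hy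
    exact ⟨x, by simpa [hn] using hy, rfl⟩
  let P := (happ.mono_set ball_subset_closedBall).toOpenPartialHomeomorph T (ball 0 2) hlt
    isOpen_ball
  have hP : ∀ x, P x = T x := fun _ => rfl
  have hsrc : closedBall (0 : E) 1 ⊆ P.source := closedBall_subset_ball one_lt_two
  have hleft : LeftInvOn P.symm T (closedBall 0 1) := fun x hx => P.left_inv (hsrc hx)
  have htgt : closedBall (0 : E) 1 ⊆ P.target := by
    intro y hy
    obtain ⟨x, hx, rfl⟩ := hsurj y hy
    exact P.map_source (hsrc hx)
  have hmaps : MapsTo P.symm (closedBall 0 1) (closedBall 0 1) := by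
    intro y hy
    obtain ⟨x, hx, rfl⟩ := hsurj y hy
    rwa [hleft hx]
  refine ⟨P.symm, hmaps, ⟨hleft, fun y hy => P.right_inv (htgt hy)⟩,
    fun x hx y hy => hlip x (closedBall_subset_closedBall one_le_two hx) y
      (closedBall_subset_closedBall one_le_two hy), fun y hy => ?_⟩
  obtain ⟨u, hu⟩ : IsUnit (fderiv ℝ T (P.symm y)) :=
    ContinuousLinearMap.isUnit_of_norm_sub_one_lt_one
      ((hc _ (closedBall_subset_closedBall one_le_two (hmaps hy))).trans_lt (by norm_num))
  have hder : HasFDerivAt P ((ContinuousLinearEquiv.unitsEquiv ℝ E u : E ≃L[ℝ] E) : E →L[ℝ] E)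
      (P.symm y) := by
    have : ((ContinuousLinearEquiv.unitsEquiv ℝ E u : E ≃L[ℝ] E) : E →L[ℝ] E) = u := by
      ext; rfl
    rw [this, hu]
    exact (hd _).hasFDerivAt
  refine ⟨P.contDiffAt_symm (htgt hy) hder hT.contDiffAt, ?_⟩
  convert P.hasFDerivAt_symm (htgt hy) hder using 1
  rw [← hu, Ring.inverse_unit]
  ext; rfl

end SphereTwist

/-! ### Linear algebra of the conformal correction. -/

section ConformalCorrection

variable {E : Type*} [NormedAddCommGroup E] [InnerProductSpace ℝ E]

/-- The reflection fixing `w`, as a continuous linear map. -/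
noncomputable def lineReflection (w : E) : E →L[ℝ] E :=
  ((ℝ ∙ w).reflection.toContinuousLinearEquiv : E →L[ℝ] E)

theorem lineReflection_apply (w v : E) : lineReflection w v = (ℝ ∙ w).reflection v := rfl

theorem lineReflection_eq (w : E) :
    lineReflection w = (2 * (‖w‖ ^ 2)⁻¹) • (innerSL ℝ w).smulRight w - 1 := by
  ext v
  rw [lineReflection_apply, Submodule.reflection_singleton_apply]
  simp only [RCLike.ofReal_real_eq_id, id_eq, sub_apply, smul_apply,
    ContinuousLinearMap.smulRight_apply, innerSL_apply_apply, one_apply_eq_self]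
  module

theorem continuousAt_lineReflection {w : E} (hw : w ≠ 0) :
    ContinuousAt (lineReflection : E → E →L[ℝ] E) w := by
  have e : (lineReflection : E → E →L[ℝ] E) =
      fun w => (2 * (‖w‖ ^ 2)⁻¹) • (innerSL ℝ w).smulRight w - 1 := funext lineReflection_eq
  rw [e]
  have h1 : ContinuousAt (fun w : E => (2 * (‖w‖ ^ 2)⁻¹ : ℝ)) w :=
    continuousAt_const.mul (ContinuousAt.inv₀ (by fun_prop) (by simpa using hw))
  have h2 : Continuous (fun w : E => (innerSL ℝ w).smulRight w) := by
    have := (ContinuousLinearMap.smulRightL ℝ E E).isBoundedBilinearMap.continuous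
    exact this.comp ((innerSL ℝ).continuous.prodMk continuous_id)
  exact (h1.smul h2.continuousAt).sub continuousAt_const

@[simp] theorem lineReflection_mul_self (w : E) : lineReflection w * lineReflection w = 1 := by
  ext v
  simp [lineReflection_apply]

@[simp] theorem lineReflection_self (w : E) : lineReflection w w = w := by
  rw [lineReflection_apply]
  exact Submodule.reflection_mem_subspace_eq_self (Submodule.mem_span_singleton_self w)

theorem lineReflection_smul {r : ℝ} (hr : r ≠ 0) (w : E) :
    lineReflection (r • w) = lineReflection w := by
  unfold lineReflection
  simp only [Submodule.span_singleton_smul_eq (IsUnit.mk0 r hr) w]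

theorem inner_lineReflection (w u v : E) :
    inner ℝ (lineReflection w u) v = inner ℝ u (lineReflection w v) := by
  have h := (ℝ ∙ w).reflection.inner_map_map u ((ℝ ∙ w).reflection v)
  rw [Submodule.reflection_reflection] at h
  exact h

theorem lineReflection_add_of_norm_eq {u p : E} (h : ‖u‖ = ‖p‖) : lineReflection (u + p) u = p := by
  have h1 := Submodule.reflection_sub (v := u) (w := -p) (by rwa [norm_neg])
  rw [sub_neg_eq_add, Submodule.reflection_orthogonal_apply] at h1
  rw [lineReflection_apply]
  exact neg_injective h1

variable [CompleteSpace E]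

/-- For invertible `D` and a unit vector `b`, the map `1 + conformalCorrection D b` turns `D` into
a conformal map while preserving the inner product with `b`. -/
noncomputable def conformalCorrection (D : E →L[ℝ] E) (b : E) : E →L[ℝ] E :=
  ‖D.adjoint b‖ • (lineReflection b * lineReflection (‖D.adjoint b‖ • b + D.adjoint b) *
    Ring.inverse D) - 1

theorem one_add_conformalCorrection_mul {D : E →L[ℝ] E} (hD : IsUnit D) (b : E) :
    ∃ (β : ℝ) (R : E ≃ₗᵢ[ℝ] E), (1 + conformalCorrection D b) * D =
      β • (R.toContinuousLinearEquiv : E →L[ℝ] E) := by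
  refine ⟨‖D.adjoint b‖, (ℝ ∙ (‖D.adjoint b‖ • b + D.adjoint b)).reflection.trans
    (ℝ ∙ b).reflection, ?_⟩
  rw [conformalCorrection, add_sub_cancel, smul_mul_assoc, mul_assoc, Ring.inverse_mul_cancel _ hD,
    mul_one]
  rfl

/-- Write `1 + A = β R D⁻¹`. The claim amounts to `(1 + A)* b = b`, that is `β R* b = D* b`, which
forces `β = ‖D* b‖`. The reflection in the line of `β b + D* b` exchanges `β b` and `D* b`, while
the one in the line of `b` fixes `b`. -/
theorem inner_conformalCorrection {D : E →L[ℝ] E} (hD : IsUnit D) {b : E} (hb : ‖b‖ = 1) (v : E) :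
    inner ℝ (conformalCorrection D b v) b = 0 := by
  have h := lineReflection_add_of_norm_eq (u := ‖D.adjoint b‖ • b) (p := D.adjoint b)
    (by simp [norm_smul, hb])
  have hv : D (Ring.inverse D v) = v := by
    have := congrArg (fun A : E →L[ℝ] E => A v) (Ring.mul_inverse_cancel D hD)
    simpa using this
  simp only [conformalCorrection, sub_apply, smul_apply,
    ContinuousLinearMap.mul_def, ContinuousLinearMap.comp_apply, one_apply_eq_self, inner_sub_left,
    real_inner_smul_left]
  rw [inner_lineReflection, lineReflection_self, inner_lineReflection, ← real_inner_smul_right,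
    ← map_smul, h, ContinuousLinearMap.adjoint_inner_right, hv, sub_self]

/-- Here both reflections are in the line of `b` and cancel. The factor `lineReflection b` is in the
definition for this purpose. -/
theorem conformalCorrection_one {b : E} (hb : ‖b‖ = 1) : conformalCorrection 1 b = 0 := by
  have h1 : (1 : E →L[ℝ] E).adjoint b = b := by
    rw [← ContinuousLinearMap.star_eq_adjoint, star_one, one_apply_eq_self]
  have h2 : ‖b‖ • b + b = (2 : ℝ) • b := by rw [hb]; module
  rw [conformalCorrection, h1, h2, lineReflection_smul two_ne_zero, lineReflection_mul_self, hb]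
  simp

theorem continuousAt_conformalCorrection {D : E →L[ℝ] E} (hD : ‖D - 1‖ < 1) {b : E}
    (hb : ‖b‖ = 1) :
    ContinuousAt (fun z : (E →L[ℝ] E) × E => conformalCorrection z.1 z.2) (D, b) := by
  have hp : Continuous (fun z : (E →L[ℝ] E) × E => z.1.adjoint z.2) :=
    (ContinuousLinearMap.adjoint.continuous.comp continuous_fst).clm_apply continuous_snd
  have hw : Continuous (fun z : (E →L[ℝ] E) × E => ‖z.1.adjoint z.2‖ • z.2 + z.1.adjoint z.2) :=
    (hp.norm.smul continuous_snd).add hp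
  have hb0 : b ≠ 0 := by rintro rfl; simp at hb
  -- The reflection axis does not degenerate: its pairing with `b` is `‖D* b‖ + ⟪b, D b⟫`, and `⟪b,
  -- D b⟫ > 0` because `‖D - 1‖ < 1`.
  have hw0 : ‖D.adjoint b‖ • b + D.adjoint b ≠ 0 := by
    intro h
    have h1 : inner ℝ (‖D.adjoint b‖ • b + D.adjoint b) b = 0 := by rw [h, inner_zero_left]
    rw [inner_add_left, real_inner_smul_left, ContinuousLinearMap.adjoint_inner_left,
      real_inner_self_eq_norm_sq, hb] at h1
    have h2 : D b = b + (D - 1) b := by simp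
    have h3 : |inner ℝ b ((D - 1) b)| < 1 := by
      refine (abs_real_inner_le_norm _ _).trans_lt ?_
      rw [hb, one_mul]
      exact ((D - 1).le_opNorm b).trans_lt (by rwa [hb, mul_one])
    rw [h2, inner_add_right, real_inner_self_eq_norm_sq, hb] at h1
    have := (abs_lt.1 h3).1
    have := norm_nonneg (D.adjoint b)
    linarith
  obtain ⟨u, rfl⟩ := ContinuousLinearMap.isUnit_of_norm_sub_one_lt_one hD
  have hinv : ContinuousAt (fun z : (E →L[ℝ] E) × E => Ring.inverse z.1) (↑u, b) :=
    ContinuousAt.comp' (g := Ring.inverse) (NormedRing.inverse_continuousAt u) continuousAt_fst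
  have h1 : ContinuousAt (fun z : (E →L[ℝ] E) × E => lineReflection z.2) (↑u, b) :=
    ContinuousAt.comp' (g := lineReflection) (continuousAt_lineReflection hb0) continuousAt_snd
  have h2 : ContinuousAt (fun z : (E →L[ℝ] E) × E =>
      lineReflection (‖z.1.adjoint z.2‖ • z.2 + z.1.adjoint z.2)) (↑u, b) :=
    ContinuousAt.comp' (g := lineReflection) (continuousAt_lineReflection hw0) hw.continuousAt
  exact (hp.norm.continuousAt.smul ((h1.mul h2).mul hinv)).sub continuousAt_const

theorem exists_conformalCorrection_small [FiniteDimensional ℝ E] {δ : ℝ} (hδ : 0 < δ) :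
    ∃ r > 0, ∀ D : E →L[ℝ] E, ‖D - 1‖ < r → ∀ b ∈ sphere (0 : E) 1,
      ‖conformalCorrection D b‖ < δ := by
  have key : ∀ᶠ D in 𝓝 (1 : E →L[ℝ] E), ∀ b ∈ sphere (0 : E) 1,
      ‖conformalCorrection D b‖ < δ := by
    refine (isCompact_sphere (0 : E) 1).eventually_forall_of_forall_eventually fun b hb => ?_
    have hb' : ‖b‖ = 1 := by simpa using hb
    exact ContinuousAt.eventually_lt
      (continuousAt_conformalCorrection (D := 1) (by simp) hb').norm continuousAt_const
      (by simpa [conformalCorrection_one hb'] using hδ)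
  obtain ⟨r, hr, h⟩ := Metric.eventually_nhds_iff.1 key
  exact ⟨r, hr, fun D hD => h (by rwa [dist_eq_norm])⟩

end ConformalCorrection

/-! ### Continuous extension from the sphere. -/

section RadialExtension

variable {E F : Type*} [NormedAddCommGroup E] [NormedSpace ℝ E] [NormedAddCommGroup F]
  [NormedSpace ℝ F]

theorem norm_radialExtension_le {g : E → F} {δ : ℝ} (hg : ∀ x ∈ sphere (0 : E) 1, ‖g x‖ ≤ δ)
    (x : E) : ‖‖x‖ • g (‖x‖⁻¹ • x)‖ ≤ ‖x‖ * δ := by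
  rcases eq_or_ne x 0 with rfl | hx
  · simp
  · rw [norm_smul, norm_norm]
    exact mul_le_mul_of_nonneg_left (hg _ (by simp [norm_smul, hx])) (norm_nonneg x)

theorem continuous_radialExtension {g : E → F} {δ : ℝ} (hg : ∀ x ∈ sphere (0 : E) 1, ‖g x‖ ≤ δ)
    (hc : ContinuousOn g (sphere 0 1)) : Continuous fun x => ‖x‖ • g (‖x‖⁻¹ • x) := by
  rw [continuous_iff_continuousAt]
  intro x
  rcases eq_or_ne x 0 with rfl | hx
  · have h : Tendsto (fun x : E => ‖x‖ * δ) (𝓝 0) (𝓝 0) := by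
      have : Continuous fun x : E => ‖x‖ * δ := by fun_prop
      simpa using this.tendsto 0
    have := squeeze_zero_norm (norm_radialExtension_le hg) h
    simpa [ContinuousAt] using this
  · have h : ContinuousOn (fun x : E => ‖x‖⁻¹ • x) {0}ᶜ :=
      (continuousOn_id.norm.inv₀ fun x hx => by simpa using hx).smul continuousOn_id
    have h2 : ContinuousOn (fun x => ‖x‖ • g (‖x‖⁻¹ • x)) {0}ᶜ :=
      continuousOn_id.norm.smul (hc.comp h fun x hx => by
        have : x ≠ 0 := hx
        simp [norm_smul, this])
    exact h2.continuousAt (isOpen_compl_singleton.mem_nhds hx)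

end RadialExtension

/-! ### Derivatives up to the boundary, and boundary values. -/

section Domain

variable {n : ℕ}

theorem IsC1Diffeo.fderivWithin_mul_fderivWithin {s t : Set (EuclideanSpace ℝ (Fin n))}
    {f g : EuclideanSpace ℝ (Fin n) → EuclideanSpace ℝ (Fin n)} (h : IsC1Diffeo s t f g)
    (ht : UniqueDiffOn ℝ t) {y : EuclideanSpace ℝ (Fin n)} (hy : y ∈ t) :
    fderivWithin ℝ f s (g y) * fderivWithin ℝ g t y = 1 := by
  have hf := (h.contDiffOn.differentiableOn (by norm_num) _ (h.mapsTo_inv hy)).hasFDerivWithinAt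
  have hg := (h.contDiffOn_inv.differentiableOn (by norm_num) _ hy).hasFDerivWithinAt
  have hid : HasFDerivWithinAt (f ∘ g) (1 : _ →L[ℝ] EuclideanSpace ℝ (Fin n)) t y :=
    (hasFDerivWithinAt_id y t).congr (fun z hz => h.invOn.2 hz) (h.invOn.2 hy)
  exact (ht y hy).eq (hf.comp y hg h.mapsTo_inv) hid

theorem IsC1Diffeo.surjective_fderivWithin_inv {s t : Set (EuclideanSpace ℝ (Fin n))}
    {f g : EuclideanSpace ℝ (Fin n) → EuclideanSpace ℝ (Fin n)} (h : IsC1Diffeo s t f g)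
    (ht : UniqueDiffOn ℝ t) {y : EuclideanSpace ℝ (Fin n)} (hy : y ∈ t) :
    Function.Surjective (fderivWithin ℝ g t y) := by
  have h1 := h.fderivWithin_mul_fderivWithin ht hy
  have hinj : Function.Injective (fderivWithin ℝ g t y) :=
    Function.LeftInverse.injective (g := fderivWithin ℝ f s (g y)) fun v => by
      simpa using congrArg (fun A : _ →L[ℝ] EuclideanSpace ℝ (Fin n) => A v) h1
  exact LinearMap.injective_iff_surjective.1 hinj

/-- The surjective derivative of `g` carries the tangent directions of `t` onto a dense span, so
derivatives within `s` are unambiguous. -/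
theorem IsC1Diffeo.uniqueDiffOn {s t : Set (EuclideanSpace ℝ (Fin n))}
    {f g : EuclideanSpace ℝ (Fin n) → EuclideanSpace ℝ (Fin n)} (h : IsC1Diffeo s t f g)
    (ht : UniqueDiffOn ℝ t) : UniqueDiffOn ℝ s := by
  intro x hx
  have hg := (h.contDiffOn_inv.differentiableOn (by norm_num) _ (h.mapsTo hx)).hasFDerivWithinAt
  have := hg.uniqueDiffWithinAt (ht _ (h.mapsTo hx))
    (h.surjective_fderivWithin_inv ht (h.mapsTo hx)).denseRange
  rw [h.invOn.1 hx] at this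
  exact this.mono (image_subset_iff.2 h.mapsTo_inv)

theorem uniqueDiffOn_closedBall {E : Type*} [NormedAddCommGroup E] [NormedSpace ℝ E] (x : E)
    {r : ℝ} (hr : 0 < r) : UniqueDiffOn ℝ (closedBall x r) :=
  uniqueDiffOn_convex (convex_closedBall x r)
    ((nonempty_ball.2 hr).mono ball_subset_interior_closedBall)

/-- Otherwise `ρ ≥ 0` around `a` with `ρ a = 0`, making `a` a critical point. -/
theorem IsBoundedC1Domain.closure_notMem_nhds {Ω : Set (EuclideanSpace ℝ (Fin n))}
    (hΩ : IsBoundedC1Domain Ω) {a : EuclideanSpace ℝ (Fin n)} (ha : a ∈ frontier Ω) :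
    closure Ω ∉ 𝓝 a := by
  intro h
  obtain ⟨r, hr, ρ, -, hpos, hzero, hd⟩ := hΩ.boundary a ha
  have haB : a ∈ ball a r := mem_ball_self hr
  have ha0 : ρ a = 0 := (hzero.subset ⟨ha, haB⟩).2
  refine hd a haB (IsLocalMin.fderiv_eq_zero ?_)
  filter_upwards [h, isOpen_ball.mem_nhds haB] with x hx hxB
  rw [ha0]
  by_cases hxΩ : x ∈ Ω
  · exact (hpos.subset ⟨hxΩ, hxB⟩).2.le
  · have hxf : x ∈ frontier Ω := ⟨hx, fun hi => hxΩ (interior_subset hi)⟩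
    exact (hzero.subset ⟨hxf, hxB⟩).2.ge

/-- If `f a` were interior to the ball, `g` would be open at `f a` and `closure Ω` would be a
neighbourhood of `a`. -/
theorem IsC1Diffeo.norm_eq_one_of_mem_frontier {Ω : Set (EuclideanSpace ℝ (Fin n))}
    (hΩ : IsBoundedC1Domain Ω) {f g : EuclideanSpace ℝ (Fin n) → EuclideanSpace ℝ (Fin n)}
    (h : IsC1Diffeo (closure Ω) (closedBall 0 1) f g) {a : EuclideanSpace ℝ (Fin n)}
    (ha : a ∈ frontier Ω) : ‖f a‖ = 1 := by
  have haK := frontier_subset_closure ha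
  have hfa := h.mapsTo haK
  refine le_antisymm (by simpa using hfa) (not_lt.1 fun hlt => ?_)
  have hB : closedBall (0 : EuclideanSpace ℝ (Fin n)) 1 ∈ 𝓝 (f a) :=
    closedBall_mem_nhds_of_mem (by simpa using hlt)
  have hsurj := h.surjective_fderivWithin_inv (uniqueDiffOn_closedBall 0 one_pos) hfa
  rw [fderivWithin_of_mem_nhds hB] at hsurj
  have hstrict := (h.contDiffOn_inv.contDiffAt hB).hasStrictFDerivAt (by norm_num)
  have hmap := hstrict.map_nhds_eq_of_surj (LinearMap.range_eq_top.2 hsurj)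
  rw [h.invOn.1 haK] at hmap
  refine hΩ.closure_notMem_nhds ha (mem_of_superset ?_ (image_subset_iff.2 h.mapsTo_inv))
  rw [← hmap]
  exact image_mem_map hB

theorem fderivWithin_sub_id {s : Set (EuclideanSpace ℝ (Fin n))}
    {f : EuclideanSpace ℝ (Fin n) → EuclideanSpace ℝ (Fin n)} {x : EuclideanSpace ℝ (Fin n)}
    (hs : UniqueDiffWithinAt ℝ s x) (hf : DifferentiableWithinAt ℝ f s x) :
    fderivWithin ℝ (fun x => f x - x) s x = fderivWithin ℝ f s x - 1 :=
  (hf.hasFDerivWithinAt.sub (hasFDerivWithinAt_id x s)).fderivWithin hs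

theorem norm_le_of_c1Norm_le {s : Set (EuclideanSpace ℝ (Fin n))}
    {f : EuclideanSpace ℝ (Fin n) → EuclideanSpace ℝ (Fin n)} {L : ℝ} (hL : 0 ≤ L)
    (h : c1Norm s f ≤ ENNReal.ofReal L) {x : EuclideanSpace ℝ (Fin n)} (hx : x ∈ s) :
    ‖f x‖ ≤ L ∧ ‖fderivWithin ℝ f s x‖ ≤ L := by
  constructor
  · rw [← ENNReal.ofReal_le_ofReal_iff hL, ofReal_norm]
    exact (le_iSup₂ (f := fun x (_ : x ∈ s) => ‖f x‖ₑ) x hx).trans (le_self_add.trans h)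
  · rw [← ENNReal.ofReal_le_ofReal_iff hL, ofReal_norm]
    exact (le_iSup₂ (f := fun x (_ : x ∈ s) => ‖fderivWithin ℝ f s x‖ₑ) x hx).trans
      (le_add_self.trans h)

theorem c1Norm_le {s : Set (EuclideanSpace ℝ (Fin n))}
    {f : EuclideanSpace ℝ (Fin n) → EuclideanSpace ℝ (Fin n)} {c d : ℝ} (hc : 0 ≤ c) (hd : 0 ≤ d)
    (h : ∀ x ∈ s, ‖f x‖ ≤ c ∧ ‖fderivWithin ℝ f s x‖ ≤ d) :
    c1Norm s f ≤ ENNReal.ofReal (c + d) := by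
  rw [ENNReal.ofReal_add hc hd]
  refine add_le_add (iSup₂_le fun x hx => ?_) (iSup₂_le fun x hx => ?_)
  · rw [← ofReal_norm]
    exact ENNReal.ofReal_le_ofReal (h x hx).1
  · rw [← ofReal_norm]
    exact ENNReal.ofReal_le_ofReal (h x hx).2

end Domain

/-! ### The corrected family and the theorem. -/

section Family

variable {n : ℕ}

/-- Composing a diffeomorphism `Φ` onto the ball with norm-preserving diffeomorphisms of the ball. -/
theorem IsC1Diffeo.comp_ball {K : Set (EuclideanSpace ℝ (Fin n))}
    {Φ Ψ T S : EuclideanSpace ℝ (Fin n) → EuclideanSpace ℝ (Fin n)}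
    (h : IsC1Diffeo K (closedBall 0 1) Φ Ψ) (hT : ContDiff ℝ 1 T) (hn : ∀ x, ‖T x‖ = ‖x‖)
    (hS : MapsTo S (closedBall 0 1) (closedBall 0 1))
    (hTS : InvOn S T (closedBall 0 1) (closedBall 0 1))
    (hSc : ContDiffOn ℝ 1 S (closedBall 0 1)) :
    IsC1Diffeo K (closedBall 0 1) (fun x => T (Φ x)) (fun y => Ψ (S y)) where
  mapsTo x hx := by simpa [hn] using h.mapsTo hx
  mapsTo_inv y hy := h.mapsTo_inv (hS hy)
  invOn := ⟨fun x hx => by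
      show Ψ (S (T (Φ x))) = x
      rw [hTS.1 (h.mapsTo hx), h.invOn.1 hx], fun y hy => by
      show T (Φ (Ψ (S y))) = y
      rw [h.invOn.2 (hS hy), hTS.2 hy]⟩
  contDiffOn := hT.comp_contDiffOn h.contDiffOn
  contDiffOn_inv := h.contDiffOn_inv.comp hSc hS

end Family

theorem proposition4p4 (n : ℕ) (hn : 3 ≤ n) (ε : ℝ) (hε : 0 < ε) :
    ∃ L : ℝ, 0 < L ∧
      ∀ Ω : Set (EuclideanSpace ℝ (Fin n)), IsBoundedC1Domain Ω →
      ∀ Φ Ψ : EuclideanSpace ℝ (Fin n) → EuclideanSpace ℝ (Fin n),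
        IsC1Diffeo (closure Ω) (closedBall 0 1) Φ Ψ →
        c1Norm (closure Ω) (fun x => Φ x - x) ≤ ENNReal.ofReal L →
        -- the family `Φ_a = F a` and the family of inverses `Φ_a⁻¹ = G a`
        ∃ F G : EuclideanSpace ℝ (Fin n) → EuclideanSpace ℝ (Fin n) → EuclideanSpace ℝ (Fin n),
          (∀ a ∈ closure Ω, IsC1Diffeo (closure Ω) (closedBall 0 1) (F a) (G a)) ∧
          (∀ a ∈ closure Ω, F a a = Φ a) ∧
          (∀ a ∈ frontier Ω,
            (∃ (β : ℝ) (R : EuclideanSpace ℝ (Fin n) ≃ₗᵢ[ℝ] EuclideanSpace ℝ (Fin n)),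
              fderivWithin ℝ (F a) (closure Ω) a =
                β • (R.toContinuousLinearEquiv :
                  EuclideanSpace ℝ (Fin n) →L[ℝ] EuclideanSpace ℝ (Fin n))) ∧
            c1Norm (closure Ω) (fun x => F a x - x) < ENNReal.ofReal ε) ∧
          (∀ a ∈ closure Ω,
            (∀ᵐ x ∂(volume.restrict (closure Ω)),
              Tendsto (fun a' => F a' x) (𝓝[closure Ω] a) (𝓝 (F a x))) ∧
            (∀ᵐ y ∂(volume.restrict (closedBall (0 : EuclideanSpace ℝ (Fin n)) 1)),
              Tendsto (fun a' => G a' y) (𝓝[closure Ω] a) (𝓝 (G a y))) ∧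
            (∀ᵐ x ∂(volume.restrict (closure Ω)),
              Tendsto (fun a' => fderivWithin ℝ (F a') (closure Ω) x) (𝓝[closure Ω] a)
                (𝓝 (fderivWithin ℝ (F a) (closure Ω) x))) ∧
            (∀ᵐ y ∂(volume.restrict (closedBall (0 : EuclideanSpace ℝ (Fin n)) 1)),
              Tendsto (fun a' => fderivWithin ℝ (G a') (closedBall 0 1) y) (𝓝[closure Ω] a)
                (𝓝 (fderivWithin ℝ (G a) (closedBall 0 1) y)))) := by
  have : Nontrivial (EuclideanSpace ℝ (Fin n)) := by
    have : Nonempty (Fin n) := ⟨⟨0, by omega⟩⟩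
    infer_instance
  obtain ⟨η, hη, hη2, hηε⟩ : ∃ η : ℝ, 0 < η ∧ η ≤ 1 / 2 ∧ η ≤ ε / 16 :=
    ⟨min (1 / 2) (ε / 16), by positivity, min_le_left _ _, min_le_right _ _⟩
  obtain ⟨r, hr, hclose⟩ := exists_sphereTwist_close (E := EuclideanSpace ℝ (Fin n)) hη
  obtain ⟨s, hs, hcorr⟩ := exists_conformalCorrection_small (E := EuclideanSpace ℝ (Fin n))
    (half_pos hr)
  obtain ⟨L, hL, hL2, hLε, hLs⟩ : ∃ L : ℝ, 0 < L ∧ L ≤ 1 / 2 ∧ L ≤ ε / 16 ∧ L ≤ s / 2 :=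
    ⟨min (1 / 2) (min (ε / 16) (s / 2)), by positivity, min_le_left _ _,
      (min_le_right _ _).trans (min_le_left _ _), (min_le_right _ _).trans (min_le_right _ _)⟩
  refine ⟨L, hL, fun Ω hΩ Φ Ψ hΦ hnorm => ?_⟩
  set K := closure Ω
  set B := closedBall (0 : EuclideanSpace ℝ (Fin n)) 1 with hBdef
  have hUB : UniqueDiffOn ℝ B := uniqueDiffOn_closedBall 0 one_pos
  have hUK : UniqueDiffOn ℝ K := hΦ.uniqueDiffOn hUB
  have hΦd : ∀ x ∈ K, HasFDerivWithinAt Φ (fderivWithin ℝ Φ K x) K x := fun x hx =>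
    (hΦ.contDiffOn.differentiableOn (by norm_num) x hx).hasFDerivWithinAt
  have hΨd : ∀ x ∈ B, HasFDerivWithinAt Ψ (fderivWithin ℝ Ψ B x) B x := fun x hx =>
    (hΦ.contDiffOn_inv.differentiableOn (by norm_num) x hx).hasFDerivWithinAt
  have hD : ∀ x ∈ K, ‖Φ x - x‖ ≤ L ∧ ‖fderivWithin ℝ Φ K x - 1‖ ≤ L := fun x hx => by
    rw [← fderivWithin_sub_id (hUK x hx) (hΦd x hx).differentiableWithinAt]
    exact norm_le_of_c1Norm_le hL.le hnorm hx
  let g : EuclideanSpace ℝ (Fin n) → EuclideanSpace ℝ (Fin n) →L[ℝ] EuclideanSpace ℝ (Fin n) :=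
    fun b => conformalCorrection (fderivWithin ℝ Φ K (Ψ b)) b
  have hSB : sphere (0 : EuclideanSpace ℝ (Fin n)) 1 ⊆ B := sphere_subset_closedBall
  have hgr : ∀ b ∈ sphere (0 : EuclideanSpace ℝ (Fin n)) 1, ‖g b‖ ≤ r / 2 := fun b hb =>
    (hcorr _ ((hD _ (hΦ.mapsTo_inv (hSB hb))).2.trans_lt (by linarith)) b hb).le
  have hgc : ContinuousOn g (sphere 0 1) := by
    intro b hb
    have h1 : ContinuousWithinAt (fun b => (fderivWithin ℝ Φ K (Ψ b), b)) (sphere 0 1) b :=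
      (((hΦ.contDiffOn.continuousOn_fderivWithin hUK le_rfl).comp hΦ.contDiffOn_inv.continuousOn
        hΦ.mapsTo_inv).mono hSB b hb).prodMk continuousWithinAt_id
    exact ContinuousAt.comp_continuousWithinAt (f := fun b => (fderivWithin ℝ Φ K (Ψ b), b))
      (continuousAt_conformalCorrection
        ((hD _ (hΦ.mapsTo_inv (hSB hb))).2.trans_lt (by linarith)) (by simpa using hb)) h1
  -- Conformality only constrains `A` on the sphere; inside, any continuous small extension serves.
  let A : EuclideanSpace ℝ (Fin n) → EuclideanSpace ℝ (Fin n) →L[ℝ] EuclideanSpace ℝ (Fin n) :=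
    fun b => ‖b‖ • g (‖b‖⁻¹ • b)
  have hAc : Continuous A := continuous_radialExtension hgr hgc
  have hAr : ∀ b ∈ B, ‖A b‖ < r := fun b hb => by
    have h1 : ‖A b‖ ≤ ‖b‖ * (r / 2) := norm_radialExtension_le hgr b
    have h2 : ‖b‖ ≤ 1 := by simpa [hBdef] using hb
    nlinarith [norm_nonneg b]
  let T : EuclideanSpace ℝ (Fin n) → EuclideanSpace ℝ (Fin n) → EuclideanSpace ℝ (Fin n) :=
    fun b => sphereTwist (A b) b
  have hT : ∀ b ∈ B, ∀ x ∈ closedBall (0 : EuclideanSpace ℝ (Fin n)) 2,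
      ‖T b x - x‖ ≤ η ∧ ‖fderiv ℝ (T b) x - 1‖ ≤ η := fun b hb => hclose (A b) (hAr b hb) b hb
  have hTd : ∀ b, ContDiff ℝ 1 (T b) := fun b =>
    (contDiff_sphereTwist_apply (A b) b).of_le (by norm_num)
  have hB2 : B ⊆ closedBall 0 2 := closedBall_subset_closedBall one_le_two
  have hS : ∀ b, ∃ S : EuclideanSpace ℝ (Fin n) → EuclideanSpace ℝ (Fin n), b ∈ B →
      MapsTo S B B ∧ InvOn S (T b) B B ∧ (∀ x ∈ B, ∀ y ∈ B, ‖x - y‖ ≤ 2 * ‖T b x - T b y‖) ∧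
      ∀ y ∈ B, ContDiffAt ℝ 1 S y ∧
        HasFDerivAt S (Ring.inverse (fderiv ℝ (T b) (S y))) y := fun b => by
    by_cases hb : b ∈ B
    · obtain ⟨S, h⟩ := exists_inverse_of_close (hTd b) (norm_sphereTwist (A b) b)
        fun x hx => (hT b hb x hx).2.trans hη2
      exact ⟨S, fun _ => h⟩
    · exact ⟨id, fun h => absurd h hb⟩
  choose S hS using hS
  have hFd : ∀ a, ∀ x ∈ K, fderivWithin ℝ (fun x => T (Φ a) (Φ x)) K x =
      fderiv ℝ (T (Φ a)) (Φ x) * fderivWithin ℝ Φ K x := fun a x hx =>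
    ((((hTd (Φ a)).differentiable (by norm_num) (Φ x)).hasFDerivAt).comp_hasFDerivWithinAt x
      (hΦd x hx)).fderivWithin (hUK x hx)
  have hGd : ∀ b ∈ B, ∀ y ∈ B, fderivWithin ℝ (fun y => Ψ (S b y)) B y =
      fderivWithin ℝ Ψ B (S b y) * Ring.inverse (fderiv ℝ (T b) (S b y)) := fun b hb y hy =>
    ((hΨd _ ((hS b hb).1 hy)).comp y ((hS b hb).2.2.2 y hy).2.hasFDerivWithinAt
      (hS b hb).1).fderivWithin (hUB y hy)
  have hdiffeo : ∀ a ∈ K, IsC1Diffeo K B (fun x => T (Φ a) (Φ x)) (fun y => Ψ (S (Φ a) y)) := by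
    intro a ha
    obtain ⟨h1, h2, -, h4⟩ := hS _ (hΦ.mapsTo ha)
    exact hΦ.comp_ball (hTd _) (norm_sphereTwist _ _) h1 h2
      fun y hy => (h4 y hy).1.contDiffWithinAt
  have hΦc : ∀ a ∈ K, Tendsto Φ (𝓝[K] a) (𝓝 (Φ a)) := fun a ha =>
    hΦ.contDiffOn.continuousOn a ha
  have hAΦ : ∀ a ∈ K, Tendsto (fun a' => A (Φ a')) (𝓝[K] a) (𝓝 (A (Φ a))) :=
    fun a ha => (hAc.tendsto (Φ a)).comp (hΦc a ha)
  have hTc : ∀ a ∈ K, ∀ x, Tendsto (fun a' => T (Φ a') x) (𝓝[K] a) (𝓝 (T (Φ a) x)) :=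
    fun a ha x => (hAΦ a ha).sphereTwist (hΦc a ha) tendsto_const_nhds
  have hTdc : ∀ a ∈ K, ∀ {w : EuclideanSpace ℝ (Fin n) → EuclideanSpace ℝ (Fin n)} {c},
      Tendsto w (𝓝[K] a) (𝓝 c) →
      Tendsto (fun a' => fderiv ℝ (T (Φ a')) (w a')) (𝓝[K] a) (𝓝 (fderiv ℝ (T (Φ a)) c)) :=
    fun a ha w c hw => (hAΦ a ha).fderiv_sphereTwist (hΦc a ha) hw
  have hSc : ∀ a ∈ K, ∀ y ∈ B, Tendsto (fun a' => S (Φ a') y) (𝓝[K] a) (𝓝[B] (S (Φ a) y)) := by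
    intro a ha y hy
    obtain ⟨h1, h2, -, -⟩ := hS _ (hΦ.mapsTo ha)
    refine tendsto_nhdsWithin_iff.2 ⟨?_, eventually_mem_nhdsWithin.mono fun a' ha' =>
      (hS _ (hΦ.mapsTo ha')).1 hy⟩
    rw [tendsto_iff_norm_sub_tendsto_zero]
    -- The lower Lipschitz bound of `T (Φ a')`, uniform in `a'`, reduces convergence of the inverses
    -- to `T (Φ a') z → T (Φ a) z = y` at the fixed point `z = S (Φ a) y`.
    have hlim : Tendsto (fun a' => 2 * ‖y - T (Φ a') (S (Φ a) y)‖) (𝓝[K] a) (𝓝 0) := by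
      have := ((hTc a ha (S (Φ a) y)).const_sub y).norm.const_mul 2
      rwa [h2.2 hy, sub_self, norm_zero, mul_zero] at this
    refine squeeze_zero' (Eventually.of_forall fun _ => norm_nonneg _)
      (eventually_mem_nhdsWithin.mono fun a' ha' => ?_) hlim
    obtain ⟨h1', h2', h3', -⟩ := hS _ (hΦ.mapsTo ha')
    have := h3' _ (h1' hy) _ (h1 hy)
    rwa [h2'.2 hy] at this
  refine ⟨fun a x => T (Φ a) (Φ x), fun a y => Ψ (S (Φ a) y), hdiffeo,
    fun a _ => sphereTwist_self _ _, fun a ha => ⟨?_, ?_⟩, fun a ha => ⟨?_, ?_, ?_, ?_⟩⟩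
  · have haK : a ∈ K := frontier_subset_closure ha
    have hb : ‖Φ a‖ = 1 := hΦ.norm_eq_one_of_mem_frontier hΩ ha
    have hunit : IsUnit (fderivWithin ℝ Φ K a) :=
      ContinuousLinearMap.isUnit_of_norm_sub_one_lt_one ((hD a haK).2.trans_lt (by linarith))
    have hA : A (Φ a) = conformalCorrection (fderivWithin ℝ Φ K a) (Φ a) := by
      simp only [A, g, hb, inv_one, one_smul, hΦ.invOn.1 haK]
    have hTa : fderiv ℝ (T (Φ a)) (Φ a) = 1 + A (Φ a) :=
      (hasFDerivAt_sphereTwist_self hb (hA ▸ inner_conformalCorrection hunit hb)).fderiv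
    rw [hFd a a haK, hTa, hA]
    exact one_add_conformalCorrection_mul hunit (Φ a)
  · have haK : a ∈ K := frontier_subset_closure ha
    -- The derivative error is at most `η L + η + L ≤ 2 η + L`, so the norm is at most `3 η + 2 L ≤
    -- 5 ε / 16`.
    refine (c1Norm_le (c := η + L) (d := 2 * η + L) (by positivity) (by positivity)
      fun x hx => ?_).trans_lt ((ENNReal.ofReal_lt_ofReal_iff hε).2 (by linarith))
    obtain ⟨h1, h2⟩ := hT _ (hΦ.mapsTo haK) _ (hB2 (hΦ.mapsTo hx))
    obtain ⟨h3, h4⟩ := hD x hx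
    constructor
    · rw [← sub_add_sub_cancel _ (Φ x)]
      exact (norm_add_le _ _).trans (add_le_add h1 h3)
    · rw [fderivWithin_sub_id (hUK x hx)
        ((hdiffeo a haK).contDiffOn.differentiableOn (by norm_num) x hx), hFd a x hx]
      set M := fderiv ℝ (T (Φ a)) (Φ x)
      set D := fderivWithin ℝ Φ K x
      have e : M * D - 1 = (M - 1) * (D - 1) + (M - 1) + (D - 1) := by
        simp only [mul_sub, sub_mul, mul_one, one_mul]
        abel
      rw [e]
      have h5 : ‖(M - 1) * (D - 1)‖ ≤ η * L :=
        (norm_mul_le _ _).trans (mul_le_mul h2 h4 (norm_nonneg _) hη.le)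
      have h6 := norm_add₃_le (a := (M - 1) * (D - 1)) (b := M - 1) (c := D - 1)
      nlinarith
  · exact ae_restrict_of_forall_mem isClosed_closure.measurableSet fun x _ => hTc a ha (Φ x)
  · refine ae_restrict_of_forall_mem isClosed_closedBall.measurableSet fun y hy => ?_
    exact (hΦ.contDiffOn_inv.continuousOn _ ((hS _ (hΦ.mapsTo ha)).1 hy)).tendsto.comp
      (hSc a ha y hy)
  · refine ae_restrict_of_forall_mem isClosed_closure.measurableSet fun x hx => ?_
    simp only [hFd _ x hx]
    exact (hTdc a ha tendsto_const_nhds).mul_const _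
  · refine ae_restrict_of_forall_mem isClosed_closedBall.measurableSet fun y hy => ?_
    obtain ⟨h1, -, -, -⟩ := hS _ (hΦ.mapsTo ha)
    obtain ⟨u, hu⟩ : IsUnit (fderiv ℝ (T (Φ a)) (S (Φ a) y)) :=
      ContinuousLinearMap.isUnit_of_norm_sub_one_lt_one
        ((hT _ (hΦ.mapsTo ha) _ (hB2 (h1 hy))).2.trans_lt (by linarith))
    have hinv : Tendsto (fun a' => Ring.inverse (fderiv ℝ (T (Φ a')) (S (Φ a') y))) (𝓝[K] a)
        (𝓝 (Ring.inverse (fderiv ℝ (T (Φ a)) (S (Φ a) y)))) := by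
      -- The base point `S (Φ a') y` moves with `a'`, so joint continuity of the twist's derivative
      -- is needed here.
      have h := hTdc a ha ((hSc a ha y hy).mono_right nhdsWithin_le_nhds)
      rw [← hu] at h ⊢
      exact (NormedRing.inverse_continuousAt u).tendsto.comp h
    have hΨ : Tendsto (fun a' => fderivWithin ℝ Ψ B (S (Φ a') y)) (𝓝[K] a)
        (𝓝 (fderivWithin ℝ Ψ B (S (Φ a) y))) :=
      ((hΦ.contDiffOn_inv.continuousOn_fderivWithin hUB le_rfl) _ (h1 hy)).tendsto.comp
        (hSc a ha y hy)
    rw [hGd _ (hΦ.mapsTo ha) y hy]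
    refine (hΨ.mul hinv).congr' (eventually_mem_nhdsWithin.mono fun a' ha' => ?_)
    exact (hGd _ (hΦ.mapsTo ha') y hy).symm
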